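/- Let $1\le p<\infty$, let $(X,\mathcal B,\mu)$ be a $\sigma$-finite measure space, and let $f:X\to X$ be a bijection such that $f(B)\in\mathcal B$ and $f^{-1}(B)\in\mathcal B$ for every $B\in\mathcal B$, such that $\mu(f^{-1}(B))=0$ if and only if $\mu(B)=0$ for every $B\in\mathcal B$, and such that for some $c>0$ one has $\mu(f^{-1}(B))\le c\,\mu(B)$ for every $B\in\mathcal B$. Let $T_f:L^p(X)\to L^p(X)$, $T_f\varphi=\varphi\circ f$, be the (bounded) composition operator on the complex space $L^p(X)=L^p(X,\mathcal B,\mu)$. Suppose that there is $W\in\mathcal B$ with $0<\mu(W)<\infty$ such that the sets $f^k(W)$, $k\in\mathbb Z$, are pairwise disjoint and have union $X$ (dissipativity), and that there is $K>0$ such that $$\frac1K\,\mu(f^k(W))\,\mu(B)\le \mu(f^k(B))\,\mu(W)\le K\,\mu(f^k(W))\,\mu(B)$$ for all $k\in\mathbb Z$ and all $B\in\mathcal B$ with $B\subseteq W$ (bounded distortion). Let $B_w$ be the weighted backward shift $B_w(\{x_n\}_{n\in\mathbb Z})=\{w_{n+1}x_{n+1}\}_{n\in\mathbb Z}$ on the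 complex space $\ell^p(\mathbb Z)$ with the (bounded) weights $$w_k=\left(\frac{\mu(f^{k-1}(W))}{\mu(f^k(W))}\right)^{1/p},\qquad k\in\mathbb Z.$$ A bounded linear operator $T$ on a complex Banach space $E$ is called strongly structurally stable if it is invertible and for every $\gamma>0$ there is $\varepsilon>0$ such that for every bounded Lipschitz map $\phi:E\to E$ with $\|\phi\|_\infty\le\varepsilon$ and $\mathrm{Lip}(\phi)\le\varepsilon$ there is a homeomorphism $h:E\to E$ with $h\circ T=(T+\phi)\circ h$ and $\|h-I\|_\infty\le\gamma$. If $B_w$ is strongly structurally stable, then so is $T_f$. -/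

import Mathlib

open MeasureTheory Set Function
open scoped ENNReal NNReal BoundedContinuousFunction

noncomputable section

/-! Strong structural stability -/

/-- A bounded linear operator `T` on a complex Banach space is strongly structurally stable if it is
invertible and for every `γ > 0` there is `ε > 0` such that for each bounded Lipschitz map `φ` with
`‖φ‖_∞ ≤ ε` and `Lip φ ≤ ε` there is a homeomorphism `h` with `h ∘ T = (T + φ) ∘ h` and
`‖h - id‖_∞ ≤ γ`. -/
def StronglyStructurallyStable {E : Type*} [NormedAddCommGroup E] [NormedSpace ℂ E]
    (T : E →L[ℂ] E) : Prop :=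
  T.IsInvertible ∧
    ∀ γ : ℝ, 0 < γ → ∃ ε : ℝ≥0, 0 < ε ∧
      ∀ φ : E →ᵇ E, ‖φ‖ ≤ ε → LipschitzWith ε φ →
        ∃ h : E ≃ₜ E, (∀ x, h (T x) = T (h x) + φ (h x)) ∧ ∀ x, ‖h x - x‖ ≤ γ

/-! Bilateral weighted backward shifts -/

section Shift

variable (p : ℝ≥0∞)

theorem weightedShift_sum_le [Fact (1 ≤ p)] (hp : p ≠ ∞) (w : ℤ → ℂ) (C : ℝ)
    (hC : ∀ n, ‖w n‖ ≤ C) (x : lp (fun _ : ℤ => ℂ) p) (s : Finset ℤ) :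
    ∑ n ∈ s, ‖w (n + 1) * x (n + 1)‖ ^ p.toReal ≤ (C * ‖x‖) ^ p.toReal := by
  have hp1 : 1 ≤ p := Fact.out
  have hp0 : 0 < p.toReal := ENNReal.toReal_pos (by positivity) hp
  have hC0 : 0 ≤ C := (norm_nonneg _).trans (hC 0)
  have h := lp.sum_rpow_le_norm_rpow hp0 x (s.map (addRightEmbedding (1 : ℤ)))
  rw [Finset.sum_map] at h
  calc ∑ n ∈ s, ‖w (n + 1) * x (n + 1)‖ ^ p.toReal
      ≤ ∑ n ∈ s, C ^ p.toReal * ‖x (n + 1)‖ ^ p.toReal := by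
        refine Finset.sum_le_sum fun n _ => ?_
        rw [← Real.mul_rpow hC0 (norm_nonneg _), norm_mul]
        gcongr
        exact hC _
    _ ≤ C ^ p.toReal * ‖x‖ ^ p.toReal := by
        rw [← Finset.mul_sum]
        gcongr
        exact h
    _ = (C * ‖x‖) ^ p.toReal := (Real.mul_rpow hC0 (norm_nonneg _)).symm

theorem weightedShift_memℓp [Fact (1 ≤ p)] (hp : p ≠ ∞) (w : ℤ → ℂ)
    (hw : ∃ C : ℝ, ∀ n, ‖w n‖ ≤ C) (x : lp (fun _ : ℤ => ℂ) p) :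
    Memℓp (fun n : ℤ => w (n + 1) * x (n + 1)) p := by
  obtain ⟨C, hC⟩ := hw
  exact memℓp_gen' fun s => weightedShift_sum_le p hp w C hC x s

/-- The bilateral weighted backward shift `B_w` on `ℓ^p(ℤ)`, `(B_w x)_n = w_{n+1} x_{n+1}`,
for a bounded weight sequence `w`. -/
def weightedShift [Fact (1 ≤ p)] (hp : p ≠ ∞) (w : ℤ → ℂ) (hw : ∃ C : ℝ, ∀ n, ‖w n‖ ≤ C) :
    lp (fun _ : ℤ => ℂ) p →L[ℂ] lp (fun _ : ℤ => ℂ) p :=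
  LinearMap.mkContinuousOfExistsBound
    { toFun := fun x => ⟨fun n => w (n + 1) * x (n + 1), weightedShift_memℓp p hp w hw x⟩
      map_add' := fun x y => by
        ext n
        exact mul_add _ _ _
      map_smul' := fun a x => by
        ext n
        simp [mul_left_comm] }
    (by
      obtain ⟨C, hC⟩ := hw
      have hp1 : 1 ≤ p := Fact.out
      refine ⟨C, fun x => lp.norm_le_of_forall_sum_le (ENNReal.toReal_pos (by positivity) hp)
        (mul_nonneg ((norm_nonneg _).trans (hC 0)) (norm_nonneg x)) fun s => ?_⟩
      exact weightedShift_sum_le p hp w C hC x s)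

theorem weightedShift_apply [Fact (1 ≤ p)] (hp : p ≠ ∞) (w : ℤ → ℂ)
    (hw : ∃ C : ℝ, ∀ n, ‖w n‖ ≤ C) (x : lp (fun _ : ℤ => ℂ) p) (n : ℤ) :
    weightedShift p hp w hw x n = w (n + 1) * x (n + 1) := rfl

end Shift

/-! Composition operators -/

section Composition

variable {X : Type*} [MeasurableSpace X]

/-- The data of a composition dynamical system: a σ-finite measure and an injective bimeasurable
transformation `f` with `μ (f⁻¹ B) ≤ c μ B` for all measurable `B`, for some `c > 0`. -/
structure IsCompositionSystem (μ : Measure X) (f : X → X) : Prop where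
  sigmaFinite : SigmaFinite μ
  injective : Injective f
  measurable : Measurable f
  measurableSet_image : ∀ B, MeasurableSet B → MeasurableSet (f '' B)
  exists_bound : ∃ c : ℝ≥0, 0 < c ∧ ∀ B, MeasurableSet B → μ (f ⁻¹' B) ≤ c * μ B

theorem IsCompositionSystem.exists_map_le {μ : Measure X} {f : X → X}
    (h : IsCompositionSystem μ f) : ∃ c : ℝ≥0, μ.map f ≤ (c : ℝ≥0∞) • μ := by
  obtain ⟨c, -, hc⟩ := h.exists_bound
  refine ⟨c, Measure.le_iff.2 fun s hs => ?_⟩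
  rw [Measure.map_apply h.measurable hs]
  simpa using hc s hs

theorem IsCompositionSystem.quasiMeasurePreserving {μ : Measure X} {f : X → X}
    (h : IsCompositionSystem μ f) : Measure.QuasiMeasurePreserving f μ μ := by
  obtain ⟨c, hc⟩ := h.exists_map_le
  exact ⟨h.measurable, Measure.absolutelyContinuous_of_le_smul hc⟩

theorem IsCompositionSystem.memLp_comp {μ : Measure X} {f : X → X} (h : IsCompositionSystem μ f)
    {p : ℝ≥0∞} {g : X → ℂ} (hg : MemLp g p μ) : MemLp (g ∘ f) p μ := by
  obtain ⟨c, hc⟩ := h.exists_map_le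
  exact (hg.of_measure_le_smul ENNReal.coe_ne_top hc).comp_of_map h.measurable.aemeasurable

theorem IsCompositionSystem.exists_eLpNorm_comp_le {μ : Measure X} {f : X → X}
    (h : IsCompositionSystem μ f) (p : ℝ≥0∞) :
    ∃ C : ℝ≥0, ∀ g : X → ℂ, MemLp g p μ → eLpNorm (g ∘ f) p μ ≤ C * eLpNorm g p μ := by
  obtain ⟨c, hc⟩ := h.exists_map_le
  have hfin : (c : ℝ≥0∞) ^ (1 / p).toReal ≠ ∞ := by simp
  refine ⟨((c : ℝ≥0∞) ^ (1 / p).toReal).toNNReal, fun g hg => ?_⟩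
  rw [ENNReal.coe_toNNReal hfin, ← eLpNorm_map_measure
    (hg.1.mono_ac (Measure.absolutelyContinuous_of_le_smul hc)) h.measurable.aemeasurable]
  exact (eLpNorm_mono_measure g hc).trans (eLpNorm_smul_measure_le _ g p μ)

/-- The composition operator `T_f : φ ↦ φ ∘ f` on the complex space `L^p(μ)`. -/
def compositionOperator (p : ℝ≥0∞) [Fact (1 ≤ p)] {μ : Measure X} {f : X → X}
    (hf : IsCompositionSystem μ f) : Lp ℂ p μ →L[ℂ] Lp ℂ p μ :=
  LinearMap.mkContinuousOfExistsBound
    { toFun := fun g => (hf.memLp_comp (Lp.memLp g)).toLp (g ∘ f)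
      map_add' := fun g₁ g₂ => by
        rw [← MemLp.toLp_add, MemLp.toLp_eq_toLp_iff]
        exact hf.quasiMeasurePreserving.ae_eq_comp (Lp.coeFn_add g₁ g₂)
      map_smul' := fun a g => by
        rw [RingHom.id_apply, ← MemLp.toLp_const_smul, MemLp.toLp_eq_toLp_iff]
        exact hf.quasiMeasurePreserving.ae_eq_comp (Lp.coeFn_smul a g) }
    (by
      obtain ⟨C, hC⟩ := hf.exists_eLpNorm_comp_le p
      refine ⟨C, fun g => ?_⟩
      have hg := Lp.memLp g
      have := ENNReal.toReal_mono (ENNReal.mul_ne_top ENNReal.coe_ne_top hg.2.ne) (hC g hg)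
      rw [ENNReal.toReal_mul, ENNReal.coe_toReal] at this
      exact (Lp.norm_toLp _ (hf.memLp_comp hg)).trans_le this)

theorem compositionOperator_coeFn (p : ℝ≥0∞) [Fact (1 ≤ p)] {μ : Measure X} {f : X → X}
    (hf : IsCompositionSystem μ f) (g : Lp ℂ p μ) :
    compositionOperator p hf g =ᵐ[μ] g ∘ f :=
  MemLp.coeFn_toLp (hf.memLp_comp (Lp.memLp g))

/-! Dissipative systems and bounded distortion, for an invertible transformation `f` -/

/-- `(X, μ, f)` is a dissipative system generated by `W`. -/
structure IsDissipativeSystem (μ : Measure X) (f : Equiv.Perm X) (W : Set X) : Prop where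
  nonsingular : ∀ B, MeasurableSet B → (μ (f ⁻¹' B) = 0 ↔ μ B = 0)
  measurableSet : MeasurableSet W
  measure_pos : 0 < μ W
  measure_lt_top : μ W < ∞
  pairwise_disjoint : Pairwise (Disjoint on fun k : ℤ => (f ^ k) '' W)
  iUnion_eq : ⋃ k : ℤ, (f ^ k) '' W = univ

/-- Bounded distortion on `W`: for some `K > 0`, all `k ∈ ℤ` and all measurable `B ⊆ W`,
`K⁻¹ μ(f^k W) μ(B) ≤ μ(f^k B) μ(W) ≤ K μ(f^k W) μ(B)`. -/
def HasBoundedDistortion (μ : Measure X) (f : Equiv.Perm X) (W : Set X) : Prop :=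
  ∃ K : ℝ≥0, 0 < K ∧ ∀ (k : ℤ) (B : Set X), MeasurableSet B → B ⊆ W →
    (K : ℝ≥0∞)⁻¹ * μ ((f ^ k) '' W) * μ B ≤ μ ((f ^ k) '' B) * μ W ∧
    μ ((f ^ k) '' B) * μ W ≤ K * μ ((f ^ k) '' W) * μ B

/-- The weights `w_k = (μ(f^{k-1} W) / μ(f^k W))^{1/p}`. -/
def systemWeight (p : ℝ≥0∞) (μ : Measure X) (f : Equiv.Perm X) (W : Set X) (k : ℤ) : ℂ :=
  (((μ ((f ^ (k - 1)) '' W) / μ ((f ^ k) '' W)).toReal ^ (1 / p.toReal) : ℝ) : ℂ)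

theorem systemWeight_bounded (p : ℝ≥0∞) {μ : Measure X} {f : Equiv.Perm X} {W : Set X}
    (hf : IsCompositionSystem μ f) (hW : IsDissipativeSystem μ f W) :
    ∃ C : ℝ, ∀ k, ‖systemWeight p μ f W k‖ ≤ C := by
  obtain ⟨c, -, hc⟩ := hf.exists_bound
  refine ⟨(c : ℝ) ^ (1 / p.toReal), fun k => ?_⟩
  have hmeas : MeasurableSet ((f ^ k) '' W) := by
    have himg : ∀ n : ℕ, ∀ B, MeasurableSet B → MeasurableSet ((f ^ n) '' B) := by
      intro n
      induction n with
      | zero => intro B hB; simpa using hB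
      | succ n ih =>
        intro B hB
        rw [pow_succ', Equiv.Perm.coe_mul, image_comp]
        exact hf.measurableSet_image _ (ih B hB)
    have hpre : ∀ n : ℕ, Measurable (f ^ n) := by
      intro n
      rw [Equiv.Perm.coe_pow]
      exact hf.measurable.iterate n
    cases k with
    | ofNat n => simpa using himg n W hW.measurableSet
    | negSucc n =>
      rw [zpow_negSucc, Equiv.Perm.inv_def, Equiv.image_symm_eq_preimage]
      exact hpre (n + 1) hW.measurableSet
  have hset : (f ^ (k - 1)) '' W = f ⁻¹' ((f ^ k) '' W) := by
    have hk : f ^ (k - 1) = f⁻¹ * f ^ k := by rw [sub_eq_neg_add, zpow_add, zpow_neg_one]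
    rw [hk, Equiv.Perm.coe_mul, image_comp, Equiv.Perm.inv_def, Equiv.image_symm_eq_preimage]
  have hle : (μ ((f ^ (k - 1)) '' W) / μ ((f ^ k) '' W)).toReal ≤ c :=
    ENNReal.toReal_le_coe_of_le_coe (ENNReal.div_le_of_le_mul (hset ▸ hc _ hmeas))
  rw [systemWeight, Complex.norm_real, Real.norm_of_nonneg (by positivity)]
  gcongr

end Composition

end

/-!
Strong structural stability of `B_w` is used only through two consequences: `B_w` is invertible,
and `1 - B_w` is onto. The second one lets us solve `y - B_w y = e_j` with `‖y‖` bounded uniformly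
in `j`. The solution is a multiple of `k ↦ μ (f^k W) ^ (1 / p)` on each side of `j`, with a jump at
`j`, so that `μ (f^j W)` dominates the sum of the `μ (f^k W)` over `k ≤ j` or over `k ≥ j`. Hence
these measures decay geometrically to the left of `j` for all `j` in a set `J ⊆ ℤ`, and to the
right of `j` for all other `j`.

By bounded distortion, the iterates of `f⁻¹` then contract `μ` geometrically on the part `S` of `X`
formed by the levels in `J`, and those of `f` do so on `Sᶜ`. So `T_f ^ k`, `k ≥ 0`, is summable on
functions supported in `S`, and `T_f ^ (-k)`, `k ≥ 1`, on functions supported in `Sᶜ`. Although `S`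
need not be invariant, these operators form a summable Green kernel for `T_f`, which is all that the
fixed-point proof of the Grobman–Hartman theorem needs.
-/

section GreenOperator

variable {𝕜 E α β : Type*} [NontriviallyNormedField 𝕜] [NormedAddCommGroup E] [NormedSpace 𝕜 E]
  [TopologicalSpace α] [TopologicalSpace β]

/-- A Green kernel of a bounded operator `T`: an absolutely summable operator-valued solution of
the difference equation `G k - T ∘ G (k - 1) = δ₀ k` on `ℤ`. -/
structure IsGreenKernel (T : E →L[𝕜] E) (G : ℤ → E →L[𝕜] E) : Prop where
  summable_norm : Summable fun k => ‖G k‖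
  eq_comp_add : ∀ k, G k = T ∘L G (k - 1) + if k = 0 then 1 else 0

/-- The `k`-th term `ψ ↦ G k ∘ ψ ∘ S ^ (-(k + 1))` of the Green operator. -/
noncomputable def greenTerm (G : ℤ → E →L[𝕜] E) (S : α ≃ₜ α) (k : ℤ) : (α →ᵇ E) →L[𝕜] α →ᵇ E :=
  (G k).compLeftContinuousBounded α ∘L
    BoundedContinuousFunction.compContinuousCLM E 𝕜 (S ^ (-(k + 1)) : α ≃ₜ α)

/-- Convolution with the kernel `G` along the orbits of `S`. When `G` is a Green kernel of `T`, it
is a right inverse of `g ↦ g ∘ S - T ∘ g`, which dictates the index shift `k + 1`. -/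
noncomputable def greenOperator (G : ℤ → E →L[𝕜] E) (S : α ≃ₜ α) : (α →ᵇ E) →L[𝕜] α →ᵇ E :=
  ∑' k, greenTerm G S k

variable {T : E →L[𝕜] E} {G : ℤ → E →L[𝕜] E}

theorem norm_greenTerm_le (S : α ≃ₜ α) (k : ℤ) : ‖greenTerm G S k‖ ≤ ‖G k‖ := by
  refine (greenTerm G S k).opNorm_le_bound (norm_nonneg _) fun ψ => ?_
  refine (BoundedContinuousFunction.norm_le (by positivity)).2 fun x => ?_
  exact (G k).le_of_opNorm_le_of_le le_rfl (ψ.norm_coe_le_norm _)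

theorem norm_greenOperator_le (hG : Summable fun k => ‖G k‖) (S : α ≃ₜ α) :
    ‖greenOperator G S‖ ≤ ∑' k, ‖G k‖ :=
  tsum_of_norm_bounded hG.hasSum (norm_greenTerm_le S)

theorem semiconj_zpow {h : α → β} {S : α ≃ₜ α} {R : β ≃ₜ β} (hS : Semiconj h S R) (k : ℤ) :
    Semiconj h (S ^ k : α ≃ₜ α) (R ^ k : β ≃ₜ β) := by
  induction k with
  | zero => exact fun _ => rfl
  | succ k ih =>
    rw [zpow_add_one, zpow_add_one]
    exact ih.comp_right hS
  | pred k ih =>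
    have hinv : Semiconj h S.symm R.symm := fun x => by
      rw [Homeomorph.eq_symm_apply, ← hS.eq, Homeomorph.apply_symm_apply]
    rw [zpow_sub_one, zpow_sub_one]
    exact ih.comp_right hinv

variable [CompleteSpace E]

theorem hasSum_greenOperator_apply (hG : Summable fun k => ‖G k‖) (S : α ≃ₜ α) (ψ : α →ᵇ E)
    (x : α) :
    HasSum (fun k => G k (ψ ((S ^ (-(k + 1)) : α ≃ₜ α) x))) (greenOperator G S ψ x) := by
  have hsum : HasSum (greenTerm G S) (greenOperator G S) :=
    (hG.of_norm_bounded (norm_greenTerm_le S)).hasSum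
  exact (hsum.mapL (ContinuousLinearMap.apply 𝕜 _ ψ)).mapL
    (BoundedContinuousFunction.evalCLM 𝕜 x)

theorem greenOperator_compContinuous (hG : Summable fun k => ‖G k‖) {S : α ≃ₜ α} {R : β ≃ₜ β}
    {h : C(α, β)} (hS : Semiconj h S R) (ψ : β →ᵇ E) :
    (greenOperator G R ψ).compContinuous h = greenOperator G S (ψ.compContinuous h) := by
  ext x
  refine (hasSum_greenOperator_apply hG R ψ (h x)).unique ?_
  simpa only [BoundedContinuousFunction.compContinuous_apply, (semiconj_zpow hS _).eq]
    using hasSum_greenOperator_apply hG S (ψ.compContinuous h) x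

theorem IsGreenKernel.greenOperator_apply_map (hG : IsGreenKernel T G) (S : α ≃ₜ α) (ψ : α →ᵇ E)
    (x : α) : greenOperator G S ψ (S x) = T (greenOperator G S ψ x) + ψ x := by
  have hshift : HasSum (fun k => T (G (k - 1) (ψ ((S ^ (-k) : α ≃ₜ α) x))))
      (T (greenOperator G S ψ x)) := by
    have := (hasSum_greenOperator_apply hG.summable_norm S ψ x).mapL T
    rw [← (Equiv.subRight (1 : ℤ)).hasSum_iff] at this
    simpa only [comp_def, Equiv.subRight_apply, sub_add_cancel] using this
  have hdelta : HasSum (fun k : ℤ => if k = 0 then ψ ((S ^ (-k) : α ≃ₜ α) x) else 0) (ψ x) :=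
    hasSum_ite_eq 0 (ψ x) |>.congr_fun fun k => by split_ifs with hk <;> simp [hk]
  refine (hasSum_greenOperator_apply hG.summable_norm S ψ (S x)).unique
    ((hshift.add hdelta).congr_fun fun k => ?_)
  have horbit : (S ^ (-(k + 1)) : α ≃ₜ α) (S x) = (S ^ (-k) : α ≃ₜ α) x := by
    rw [neg_add, ← Homeomorph.mul_apply, zpow_add, mul_assoc, zpow_neg_one, inv_mul_cancel,
      mul_one]
  rw [horbit, hG.eq_comp_add k]
  split_ifs <;> simp

end GreenOperator

section GreenConjugacy

variable {𝕜 E : Type*} [NontriviallyNormedField 𝕜] [NormedAddCommGroup E] [NormedSpace 𝕜 E]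
  {T : E →L[𝕜] E} {G : ℤ → E →L[𝕜] E} {S R : E ≃ₜ E} {φ ψ χ u v : E →ᵇ E} {ε : ℝ≥0}

/-- The continuous map `id + u`. -/
def idAdd (u : E →ᵇ E) : C(E, E) where
  toFun x := x + u x

/-- `id + u` is the conjugacy that the Green operator selects from `S = T + φ` to `T + ψ`: the
conjugacy equation `u ∘ S - T ∘ u = ψ ∘ (id + u) - φ` is solved by means of the Green operator.
A Green operator is only a one-sided inverse, so not every conjugacy is of this form. -/
def IsGreenConjugacy (G : ℤ → E →L[𝕜] E) (S : E ≃ₜ E) (φ ψ u : E →ᵇ E) : Prop :=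
  greenOperator G S (ψ.compContinuous (idAdd u) - φ) = u

theorem idAdd_apply (u : E →ᵇ E) (x : E) : idAdd u x = x + u x := rfl

theorem idAdd_zero : idAdd (0 : E →ᵇ E) = .id E :=
  ContinuousMap.ext add_zero

theorem idAdd_comp_idAdd (v u : E →ᵇ E) :
    (idAdd v).comp (idAdd u) = idAdd (u + v.compContinuous (idAdd u)) :=
  ContinuousMap.ext fun x => add_assoc x (u x) _

theorem norm_compContinuous_idAdd_sub_le (hψ : LipschitzWith ε ψ) (u v : E →ᵇ E) :
    ‖ψ.compContinuous (idAdd u) - ψ.compContinuous (idAdd v)‖ ≤ ε * ‖u - v‖ := by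
  refine (BoundedContinuousFunction.norm_le (by positivity)).2 fun x => ?_
  calc ‖ψ (x + u x) - ψ (x + v x)‖ ≤ ε * ‖x + u x - (x + v x)‖ := hψ.norm_sub_le _ _
    _ = ε * ‖(u - v) x‖ := by rw [add_sub_add_left_eq_sub, BoundedContinuousFunction.sub_apply]
    _ ≤ ε * ‖u - v‖ := by gcongr; exact (u - v).norm_coe_le_norm x

theorem isGreenConjugacy_self (G : ℤ → E →L[𝕜] E) (S : E ≃ₜ E) (φ : E →ᵇ E) :
    IsGreenConjugacy G S φ φ 0 := by
  have : φ.compContinuous (idAdd 0) = φ := by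
    rw [idAdd_zero]
    rfl
  rw [IsGreenConjugacy, this, sub_self, map_zero]

theorem IsGreenConjugacy.norm_le (hG : Summable fun k => ‖G k‖)
    (hu : IsGreenConjugacy G S φ ψ u) : ‖u‖ ≤ (∑' k, ‖G k‖) * (‖ψ‖ + ‖φ‖) := by
  rw [← hu]
  refine (greenOperator G S).le_of_opNorm_le_of_le (norm_greenOperator_le hG S) ?_
  exact (norm_sub_le _ _).trans (add_le_add_left (ψ.norm_compContinuous_le _) _)

theorem contractingWith_greenOperator (hG : Summable fun k => ‖G k‖) (S : E ≃ₜ E) (φ : E →ᵇ E)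
    (hψ : LipschitzWith ε ψ) (hε : (∑' k, ‖G k‖₊) * ε < 1) :
    ContractingWith ((∑' k, ‖G k‖₊) * ε)
      fun u => greenOperator G S (ψ.compContinuous (idAdd u) - φ) := by
  refine ⟨hε, LipschitzWith.of_dist_le_mul fun u v => ?_⟩
  rw [dist_eq_norm, dist_eq_norm, ← map_sub, sub_sub_sub_cancel_right]
  push_cast
  rw [mul_assoc]
  exact (greenOperator G S).le_of_opNorm_le_of_le (norm_greenOperator_le hG S)
    (norm_compContinuous_idAdd_sub_le hψ u v)

variable [CompleteSpace E]

theorem existsUnique_isGreenConjugacy (hG : Summable fun k => ‖G k‖) (S : E ≃ₜ E) (φ : E →ᵇ E)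
    (hψ : LipschitzWith ε ψ) (hε : (∑' k, ‖G k‖₊) * ε < 1) :
    ∃! u, IsGreenConjugacy G S φ ψ u :=
  have hcontr := contractingWith_greenOperator hG S φ hψ hε
  ⟨hcontr.fixedPoint, hcontr.fixedPoint_isFixedPt, fun _ hu => hcontr.fixedPoint_unique hu⟩

theorem IsGreenConjugacy.semiconj (hG : IsGreenKernel T G) (hS : ∀ x, S x = T x + φ x)
    (hR : ∀ x, R x = T x + ψ x) (hu : IsGreenConjugacy G S φ ψ u) : Semiconj (idAdd u) S R := by
  intro x
  have hux := hG.greenOperator_apply_map S (ψ.compContinuous (idAdd u) - φ) x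
  rw [hu, BoundedContinuousFunction.sub_apply, BoundedContinuousFunction.compContinuous_apply]
    at hux
  rw [idAdd_apply, hux, hS, hR, idAdd_apply, T.map_add]
  abel

theorem IsGreenConjugacy.comp (hG : Summable fun k => ‖G k‖) (hu : IsGreenConjugacy G S φ ψ u)
    (hv : IsGreenConjugacy G R ψ χ v) (hSR : Semiconj (idAdd u) S R) :
    IsGreenConjugacy G S φ χ (u + v.compContinuous (idAdd u)) := by
  have hvu : greenOperator G S ((χ.compContinuous (idAdd v) - ψ).compContinuous (idAdd u)) =
      v.compContinuous (idAdd u) := by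
    rw [← greenOperator_compContinuous hG hSR, hv]
  rw [IsGreenConjugacy, ← idAdd_comp_idAdd]
  refine Eq.trans ?_ (congrArg₂ (· + ·) hu hvu)
  rw [← map_add]
  congr 1
  ext x
  simp

theorem IsGreenConjugacy.leftInverse (hG : IsGreenKernel T G) (hS : ∀ x, S x = T x + φ x)
    (hR : ∀ x, R x = T x + ψ x) (hφ : LipschitzWith ε φ) (hε : (∑' k, ‖G k‖₊) * ε < 1)
    (hu : IsGreenConjugacy G S φ ψ u) (hv : IsGreenConjugacy G R ψ φ v) :
    LeftInverse (idAdd v) (idAdd u) := by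
  have huv : u + v.compContinuous (idAdd u) = 0 :=
    (existsUnique_isGreenConjugacy hG.summable_norm S φ hφ hε).unique
      (hu.comp hG.summable_norm hv (hu.semiconj hG hS hR)) (isGreenConjugacy_self G S φ)
  intro x
  rw [← ContinuousMap.comp_apply, idAdd_comp_idAdd, huv, idAdd_zero, ContinuousMap.id_apply]

/-- A Grobman–Hartman theorem for operators with a Green kernel. -/
theorem IsGreenKernel.exists_homeomorph_semiconj (hG : IsGreenKernel T G)
    (hS : ∀ x, S x = T x + φ x) (hR : ∀ x, R x = T x + ψ x) (hφ : LipschitzWith ε φ)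
    (hψ : LipschitzWith ε ψ) (hε : (∑' k, ‖G k‖₊) * ε < 1) :
    ∃ h : E ≃ₜ E, Semiconj h S R ∧ ∀ x, ‖h x - x‖ ≤ (∑' k, ‖G k‖) * (‖ψ‖ + ‖φ‖) := by
  obtain ⟨u, hu, -⟩ := existsUnique_isGreenConjugacy hG.summable_norm S φ hψ hε
  obtain ⟨v, hv, -⟩ := existsUnique_isGreenConjugacy hG.summable_norm R ψ hφ hε
  refine ⟨⟨⟨idAdd u, idAdd v, hu.leftInverse hG hS hR hφ hε hv,
    hv.leftInverse hG hR hS hψ hε hu⟩, (idAdd u).continuous, (idAdd v).continuous⟩,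
    hu.semiconj hG hS hR, fun x => ?_⟩
  calc ‖idAdd u x - x‖ = ‖u x‖ := by rw [idAdd_apply, add_sub_cancel_left]
    _ ≤ ‖u‖ := u.norm_coe_le_norm x
    _ ≤ _ := hu.norm_le hG.summable_norm

end GreenConjugacy

section StrongStructuralStability

theorem exists_homeomorph_eq_add {𝕜 E : Type*} [NontriviallyNormedField 𝕜] [NormedAddCommGroup E]
    [NormedSpace 𝕜 E] [CompleteSpace E] (T : E ≃L[𝕜] E) {φ : E → E} {ε : ℝ≥0}
    (hφ : LipschitzWith ε φ) (hε : ‖(T.symm : E →L[𝕜] E)‖₊ * ε < 1) :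
    ∃ S : E ≃ₜ E, ∀ x, S x = T x + φ x := by
  have happrox : ApproximatesLinearOn (fun x => T x + φ x) (T : E →L[𝕜] E) univ ε := by
    intro x _ y _
    simpa [add_sub_add_comm, map_sub] using hφ.norm_sub_le x y
  have hsmall : Subsingleton E ∨ ε < ‖(T.symm : E →L[𝕜] E)‖₊⁻¹ :=
    T.subsingleton_or_nnnorm_symm_pos.imp_right fun hpos => by
      rwa [NNReal.lt_inv_iff_mul_lt hpos.ne', mul_comm]
  exact ⟨happrox.toHomeomorph _ hsmall, fun _ => rfl⟩

variable {E : Type*} [NormedAddCommGroup E] [NormedSpace ℂ E]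

theorem IsGreenKernel.stronglyStructurallyStable [CompleteSpace E] {T : E ≃L[ℂ] E}
    {G : ℤ → E →L[ℂ] E} (hG : IsGreenKernel (T : E →L[ℂ] E) G) :
    StronglyStructurallyStable (T : E →L[ℂ] E) := by
  refine ⟨⟨T, rfl⟩, fun γ hγ => ?_⟩
  lift γ to ℝ≥0 using hγ.le
  obtain ⟨ε, hε, hlt⟩ := exists_pos_mul_lt (lt_min (NNReal.coe_pos.1 hγ) one_pos)
    (∑' k, ‖G k‖₊ + ‖(T.symm : E →L[ℂ] E)‖₊)
  rw [add_mul, lt_min_iff] at hlt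
  have hGγ : (∑' k, ‖G k‖₊) * ε < γ := le_self_add.trans_lt hlt.1
  have hGε : (∑' k, ‖G k‖₊) * ε < 1 := le_self_add.trans_lt hlt.2
  have hTε : ‖(T.symm : E →L[ℂ] E)‖₊ * ε < 1 := le_add_self.trans_lt hlt.2
  refine ⟨ε, hε, fun φ hφε hφ => ?_⟩
  obtain ⟨S, hS⟩ := exists_homeomorph_eq_add T hφ hTε
  obtain ⟨h, hconj, hbound⟩ := hG.exists_homeomorph_semiconj (S := T.toHomeomorph) (φ := 0)
    (fun x => (add_zero (T x)).symm) hS (LipschitzWith.const' 0 : LipschitzWith ε _) hφ hGε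
  refine ⟨h, fun x => (hconj x).trans (hS _), fun x => (hbound x).trans ?_⟩
  calc (∑' k, ‖G k‖) * (‖φ‖ + ‖(0 : E →ᵇ E)‖) ≤ (∑' k, ‖G k‖) * ε := by
        rw [norm_zero, add_zero]
        gcongr
    _ ≤ γ := by simpa [NNReal.coe_tsum] using NNReal.coe_le_coe.2 hGγ.le

/-- Perturbing by a small constant `z`, the image of `0` under the conjugacy solves
`x - T x = z`. -/
theorem StronglyStructurallyStable.surjective_one_sub {T : E →L[ℂ] E}
    (hT : StronglyStructurallyStable T) : Surjective (1 - T : E →L[ℂ] E) := by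
  obtain ⟨ε, hε, hstable⟩ := hT.2 1 one_pos
  have hball : Metric.closedBall 0 ε ⊆ ((1 - T : E →L[ℂ] E).range : Set E) := by
    intro z hz
    obtain ⟨h, hconj, -⟩ := hstable (.const E z)
      ((BoundedContinuousFunction.norm_const_le z).trans (mem_closedBall_zero_iff.1 hz))
      (LipschitzWith.const' z)
    refine ⟨h 0, sub_eq_of_eq_add' ?_⟩
    simpa using hconj 0
  refine LinearMap.range_eq_top.1 (Submodule.eq_top_of_nonempty_interior' _ ⟨0, ?_⟩)
  exact mem_interior_iff_mem_nhds.2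
    (Filter.mem_of_superset (Metric.closedBall_mem_nhds 0 (NNReal.coe_pos.2 hε)) hball)

end StrongStructuralStability

section Splitting

variable {𝕜 E : Type*} [NontriviallyNormedField 𝕜] [NormedAddCommGroup E] [NormedSpace 𝕜 E]

/-- The candidate Green kernel of `T` that propagates the component selected by `P` forward and
the complementary one backward. The operator `P` need not be a projection commuting with `T`. -/
noncomputable def splittingKernel (T : E ≃L[𝕜] E) (P : E →L[𝕜] E) (k : ℤ) : E →L[𝕜] E :=
  ((T ^ k : E ≃L[𝕜] E) : E →L[𝕜] E) ∘L if 0 ≤ k then P else P - 1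

theorem isGreenKernel_splittingKernel {T : E ≃L[𝕜] E} {P : E →L[𝕜] E}
    (hforward : Summable fun n : ℕ => ‖((T ^ (n : ℤ) : E ≃L[𝕜] E) : E →L[𝕜] E) ∘L P‖)
    (hbackward : Summable fun n : ℕ =>
      ‖((T ^ (-(n + 1) : ℤ) : E ≃L[𝕜] E) : E →L[𝕜] E) ∘L (P - 1)‖) :
    IsGreenKernel (T : E →L[𝕜] E) (splittingKernel T P) where
  summable_norm := by
    refine .of_nat_of_neg_add_one (hforward.congr fun n => ?_) (hbackward.congr fun n => ?_)
    · rw [splittingKernel, if_pos n.cast_nonneg]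
    · rw [splittingKernel, if_neg (by lia)]
  eq_comp_add k := by
    have hpow : (T : E →L[𝕜] E) ∘L ((T ^ (k - 1) : E ≃L[𝕜] E) : E →L[𝕜] E) =
        ((T ^ k : E ≃L[𝕜] E) : E →L[𝕜] E) := by
      change ((T * T ^ (k - 1) : E ≃L[𝕜] E) : E →L[𝕜] E) = _
      rw [mul_self_zpow, sub_add_cancel]
    simp only [splittingKernel, ← ContinuousLinearMap.comp_assoc, hpow]
    rcases lt_trichotomy k 0 with hk | rfl | hk
    · rw [if_neg hk.not_ge, if_neg (by lia), if_neg hk.ne, add_zero]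
    · ext x
      simp
    · rw [if_pos hk.le, if_pos (by lia), if_neg hk.ne', add_zero]

end Splitting

section TailSums

theorem tsum_add_succ_le {a : ℕ → ℝ≥0∞} {D : ℝ≥0} {k : ℕ} (ha : ∑' n, a (n + k) ≤ D * a k) :
    ∑' n, a (n + (k + 1)) ≤ (D / (D + 1) : ℝ≥0) * ∑' n, a (n + k) := by
  have hsplit : ∑' n, a (n + k) = a k + ∑' n, a (n + (k + 1)) := by
    rw [tsum_eq_zero_add' ENNReal.summable, zero_add]
    simp only [add_assoc, add_comm 1 k]
  rw [ENNReal.coe_div (by positivity), ← ENNReal.mul_div_right_comm,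
    ENNReal.le_div_iff_mul_le (Or.inl (by simp)) (Or.inl (by simp))]
  calc (∑' n, a (n + (k + 1))) * (D + 1 : ℝ≥0)
      = D * ∑' n, a (n + (k + 1)) + ∑' n, a (n + (k + 1)) := by push_cast; ring
    _ ≤ D * ∑' n, a (n + (k + 1)) + D * a k := by
        gcongr
        exact (hsplit ▸ le_add_self).trans ha
    _ = D * ∑' n, a (n + k) := by rw [hsplit]; ring

theorem le_geometric_of_tsum_le {a : ℕ → ℝ≥0∞} {D : ℝ≥0}
    (ha : ∀ k, ∑' n, a (n + k) ≤ D * a k) (k : ℕ) :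
    a k ≤ (D * (D / (D + 1)) ^ k : ℝ≥0) * a 0 := by
  have htail : ∑' n, a (n + k) ≤ ((D / (D + 1)) ^ k : ℝ≥0) * ∑' n, a n := by
    induction k with
    | zero => simp
    | succ k ih =>
      rw [pow_succ', ENNReal.coe_mul, mul_assoc]
      exact (tsum_add_succ_le (ha k)).trans (by gcongr)
  calc a k ≤ ∑' n, a (n + k) := by simpa using ENNReal.le_tsum (f := fun n => a (n + k)) 0
    _ ≤ ((D / (D + 1)) ^ k : ℝ≥0) * ∑' n, a n := htail
    _ ≤ ((D / (D + 1)) ^ k : ℝ≥0) * (D * a 0) := by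
        gcongr
        exact ha 0
    _ = (D * (D / (D + 1)) ^ k : ℝ≥0) * a 0 := by push_cast; ring

/-- The sum of a bilateral sequence over the indices `≤ j`. -/
noncomputable def leftTail (m : ℤ → ℝ≥0∞) (j : ℤ) : ℝ≥0∞ := ∑' n : ℕ, m (j - n)

/-- The sum of a bilateral sequence over the indices `≥ j`. -/
noncomputable def rightTail (m : ℤ → ℝ≥0∞) (j : ℤ) : ℝ≥0∞ := ∑' n : ℕ, m (j + n)

/-- With rate `θ < 1`, the sequence `m` decays geometrically to the left of every index in `J` and
to the right of every other index. -/
structure IsGeometricDichotomy (m : ℤ → ℝ≥0∞) (J : Set ℤ) (D θ : ℝ≥0) : Prop where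
  rate_lt_one : θ < 1
  left_decay : ∀ j ∈ J, ∀ k : ℕ, m (j - k) ≤ (D * θ ^ k : ℝ≥0) * m j
  right_decay : ∀ j ∉ J, ∀ k : ℕ, m (j + k) ≤ (D * θ ^ k : ℝ≥0) * m j

variable {m : ℤ → ℝ≥0∞} {C D : ℝ≥0} {i j : ℤ}

theorem le_rightTail (hij : i ≤ j) : m j ≤ rightTail m i := by
  obtain ⟨l, rfl⟩ := Int.exists_add_of_le hij
  exact ENNReal.le_tsum (f := fun n : ℕ => m (i + n)) l

theorem rightTail_eq_add (m : ℤ → ℝ≥0∞) (j : ℤ) : rightTail m j = m j + rightTail m (j + 1) := by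
  rw [rightTail, rightTail, tsum_eq_zero_add' ENNReal.summable]
  simp only [Nat.cast_zero, add_zero, Nat.cast_add, Nat.cast_one, add_assoc, add_comm (1 : ℤ)]

theorem leftTail_mono (m : ℤ → ℝ≥0∞) : Monotone (leftTail m) := by
  intro i j hij
  obtain ⟨l, rfl⟩ := Int.exists_add_of_le hij
  have hshift : leftTail m i = ∑' n : ℕ, m (i + l - (n + l : ℕ)) :=
    tsum_congr fun n => congrArg m (by push_cast; ring)
  rw [hshift]
  exact ENNReal.tsum_comp_le_tsum_of_injective (add_left_injective l) fun n : ℕ => m (i + l - n)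

theorem le_geometric_of_leftTail_le (h : ∀ i ≤ j, leftTail m i ≤ D * m i) (k : ℕ) :
    m (j - k) ≤ (D * (D / (D + 1)) ^ k : ℝ≥0) * m j := by
  have htail (k : ℕ) : ∑' n : ℕ, m (j - (n + k : ℕ)) ≤ D * m (j - k) := by
    simpa only [leftTail, sub_sub, Nat.cast_add, add_comm] using h (j - k) (by simp)
  simpa using le_geometric_of_tsum_le (a := fun n => m (j - n)) htail k

theorem le_geometric_of_rightTail_le (h : ∀ i ≥ j, rightTail m i ≤ D * m i) (k : ℕ) :
    m (j + k) ≤ (D * (D / (D + 1)) ^ k : ℝ≥0) * m j := by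
  have htail (k : ℕ) : ∑' n : ℕ, m (j + (n + k : ℕ)) ≤ D * m (j + k) := by
    simpa only [rightTail, add_assoc, Nat.cast_add, add_comm] using h (j + k) (by simp)
  simpa using le_geometric_of_tsum_le (a := fun n => m (j + n)) htail k

/-- If `m i` dominates its right but not its left tail, then no later `m j` can dominate its left
tail: that tail contains the left tail of `i`, while `m j` is bounded by a multiple of `m i`. -/
theorem rightTail_le_of_not_leftTail_le (h : ∀ j, leftTail m j ≤ C * m j ∨ rightTail m j ≤ C * m j)
    (hij : i ≤ j) (hi : ¬ leftTail m i ≤ (C * C + C : ℝ≥0) * m i) : rightTail m j ≤ C * m j := by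
  refine (h j).resolve_left fun hj => hi ?_
  rcases h i with hl | hr
  · exact hl.trans (by gcongr; exact le_add_self)
  calc leftTail m i ≤ leftTail m j := leftTail_mono m hij
    _ ≤ C * m j := hj
    _ ≤ C * (C * m i) := by
        gcongr
        exact (le_rightTail hij).trans hr
    _ = (C * C : ℝ≥0) * m i := by rw [← mul_assoc, ENNReal.coe_mul]
    _ ≤ (C * C + C : ℝ≥0) * m i := by
        gcongr
        exact le_self_add

theorem exists_isGeometricDichotomy
    (h : ∀ j, leftTail m j ≤ C * m j ∨ rightTail m j ≤ C * m j) :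
    ∃ J D θ, IsGeometricDichotomy m J D θ := by
  let D := C * C + C
  refine ⟨{j | ∀ i ≤ j, leftTail m i ≤ D * m i}, D, D / (D + 1),
    (div_lt_one (by positivity)).2 (lt_add_one D), fun j hj => le_geometric_of_leftTail_le hj,
    fun j hj => le_geometric_of_rightTail_le fun l hl => ?_⟩
  obtain ⟨i, hij, hi⟩ : ∃ i ≤ j, ¬ leftTail m i ≤ D * m i := by simpa using hj
  refine (rightTail_le_of_not_leftTail_le h (hij.trans hl) hi).trans ?_
  gcongr
  exact le_add_self

end TailSums

section WeightedShift

variable {p : ℝ≥0∞} [Fact (1 ≤ p)] {w v : ℤ → ℂ} (hw : ∃ C : ℝ, ∀ n, ‖w n‖ ≤ C)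

theorem eq_left_of_eq_succ {α : Type*} {u : ℤ → α} {j : ℤ} (h : ∀ k ≠ j, u k = u (k + 1)) (n : ℕ) :
    u (j - n) = u j := by
  induction n with
  | zero => simp
  | succ n ih => rw [h _ (by lia), ← ih, Nat.cast_succ, sub_add_eq_sub_sub, sub_add_cancel]

theorem eq_right_of_eq_succ {α : Type*} {u : ℤ → α} {j : ℤ} (h : ∀ k ≠ j, u k = u (k + 1))
    (n : ℕ) : u (j + 1 + n) = u (j + 1) := by
  induction n with
  | zero => simp
  | succ n ih => rw [Nat.cast_succ, ← add_assoc, ← h _ (by lia), ih]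

theorem tsum_enorm_comp_rpow_le {ι κ : Type*} {F : ι → Type*} [∀ i, NormedAddCommGroup (F i)]
    (hp : p ≠ ∞) (y : lp F p) {e : κ → ι} (he : Injective e) :
    ∑' n, ‖y (e n)‖ₑ ^ p.toReal ≤ ‖y‖ₑ ^ p.toReal := by
  have hp0 := (ENNReal.toReal_pos_iff_ne_top p).2 hp
  refine ENNReal.summable.tsum_le_of_sum_le fun s => ?_
  have h := lp.sum_rpow_le_norm_rpow hp0 y (s.map ⟨e, he⟩)
  simp only [Finset.sum_map, Embedding.coeFn_mk] at h
  simp only [enorm_eq_nnnorm, ← ENNReal.coe_rpow_of_nonneg _ hp0.le]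
  norm_cast
  rw [← NNReal.coe_le_coe]
  push_cast
  exact h

theorem tsum_enorm_rpow_le_of_eq_mul (hp : p ≠ ∞) {y : lp (fun _ : ℤ => ℂ) p}
    {e : ℕ → ℤ} (he : Injective e) {c : ℂ} (hy : ∀ n, y (e n) = v (e n) * c) {j : ℤ}
    (hc : 1 ≤ 2 * ‖v j * c‖ₑ) :
    ∑' n, ‖v (e n)‖ₑ ^ p.toReal ≤ (2 * ‖y‖ₑ) ^ p.toReal * ‖v j‖ₑ ^ p.toReal := by
  have hp0 := (ENNReal.toReal_pos_iff_ne_top p).2 hp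
  calc ∑' n, ‖v (e n)‖ₑ ^ p.toReal
      ≤ ∑' n, (‖y (e n)‖ₑ * (2 * ‖v j‖ₑ)) ^ p.toReal := by
        gcongr with n
        calc ‖v (e n)‖ₑ ≤ ‖v (e n)‖ₑ * (2 * ‖v j * c‖ₑ) := le_mul_of_one_le_right' hc
          _ = ‖y (e n)‖ₑ * (2 * ‖v j‖ₑ) := by rw [hy, enorm_mul, enorm_mul]; ring
    _ = (∑' n, ‖y (e n)‖ₑ ^ p.toReal) * (2 * ‖v j‖ₑ) ^ p.toReal := by
        simp only [ENNReal.mul_rpow_of_nonneg _ _ hp0.le, ENNReal.tsum_mul_right]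
    _ ≤ ‖y‖ₑ ^ p.toReal * (2 * ‖v j‖ₑ) ^ p.toReal := by
        gcongr
        exact tsum_enorm_comp_rpow_le hp y he
    _ = (2 * ‖y‖ₑ) ^ p.toReal * ‖v j‖ₑ ^ p.toReal := by
        simp only [ENNReal.mul_rpow_of_nonneg _ _ hp0.le]
        ring

theorem weightedShift_single (hp : p ≠ ∞) (k : ℤ) (a : ℂ) :
    weightedShift p hp w hw (lp.single p k a) = lp.single p (k - 1) (w k * a) := by
  ext n
  rw [weightedShift_apply]
  obtain rfl | hn := eq_or_ne n (k - 1)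
  · rw [lp.single_apply_self, sub_add_cancel, lp.single_apply_self]
  · rw [lp.single_apply_ne _ _ _ hn, lp.single_apply_ne _ _ _ (by lia), mul_zero]

theorem exists_one_le_mul_norm_weight (hp : p ≠ ∞) (h : (weightedShift p hp w hw).IsInvertible) :
    ∃ N : ℝ≥0, ∀ k, 1 ≤ N * ‖w k‖ := by
  obtain ⟨e, he⟩ := h
  have hp0 : 0 < p := zero_lt_one.trans_le Fact.out
  refine ⟨‖(e.symm : lp (fun _ : ℤ => ℂ) p →L[ℂ] lp (fun _ : ℤ => ℂ) p)‖₊, fun k => ?_⟩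
  have hek : e.symm (lp.single p (k - 1) (w k)) = lp.single p k 1 := by
    rw [e.symm_apply_eq, ← e.coe_coe, he, weightedShift_single, mul_one]
  calc 1 = ‖e.symm (lp.single p (k - 1) (w k))‖ := by rw [hek, lp.norm_single hp0, norm_one]
    _ ≤ _ := (e.symm : lp (fun _ : ℤ => ℂ) p →L[ℂ] lp (fun _ : ℤ => ℂ) p).le_opNorm _
    _ = _ := by rw [lp.norm_single hp0, coe_nnnorm]

/-- In terms of `u = y / v`, the equation `y - B_w y = e_j` says that `u` is constant up to `j` and
from `j + 1` on, with a jump of size `1 / |v j|` in between. One of the two constants is therefore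
at least half as large, and `y ∈ ℓ^p` bounds the tail of `|v| ^ p` on the corresponding side. -/
theorem tail_le_of_sub_weightedShift_eq_single (hp : p ≠ ∞) (hv : ∀ k, v k ≠ 0)
    (hwv : ∀ k, w (k + 1) * v (k + 1) = v k) {y : lp (fun _ : ℤ => ℂ) p} {j : ℤ}
    (hy : y - weightedShift p hp w hw y = lp.single p j 1) :
    leftTail (fun k => ‖v k‖ₑ ^ p.toReal) j ≤ ((2 * ‖y‖ₑ) ^ p.toReal + 1) * ‖v j‖ₑ ^ p.toReal ∨
      rightTail (fun k => ‖v k‖ₑ ^ p.toReal) j ≤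
        ((2 * ‖y‖ₑ) ^ p.toReal + 1) * ‖v j‖ₑ ^ p.toReal := by
  obtain ⟨u, hu⟩ : ∃ u : ℤ → ℂ, ∀ k, y k = v k * u k :=
    ⟨fun k => y k / v k, fun k => (mul_div_cancel₀ _ (hv k)).symm⟩
  have hdiff (k : ℤ) : v k * (u k - u (k + 1)) = (lp.single p j 1 : lp (fun _ : ℤ => ℂ) p) k := by
    rw [← hy, lp.coeFn_sub, Pi.sub_apply, weightedShift_apply, hu, hu, ← mul_assoc, hwv, mul_sub]
  have hconst : ∀ k ≠ j, u k = u (k + 1) := fun k hk =>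
    sub_eq_zero.1 ((mul_eq_zero_iff_left (hv k)).1 ((hdiff k).trans (lp.single_apply_ne _ _ _ hk)))
  have hjump : ‖v j * u j - v j * u (j + 1)‖₊ = 1 := by
    rw [← mul_sub, hdiff, lp.single_apply_self, nnnorm_one]
  have hhalf : 1 ≤ 2 * ‖v j * u j‖ₑ ∨ 1 ≤ 2 * ‖v j * u (j + 1)‖ₑ := by
    have hsum : 1 ≤ ‖v j * u j‖₊ + ‖v j * u (j + 1)‖₊ := hjump ▸ nnnorm_sub_le _ _
    simp only [enorm_eq_nnnorm]
    norm_cast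
    by_contra!
    linarith
  refine hhalf.imp (fun hj => ?_) fun hj => ?_
  · refine (tsum_enorm_rpow_le_of_eq_mul hp (y := y) (e := fun n : ℕ => j - n)
      (fun a b hab => by simpa using hab) (fun n => ?_) hj).trans ?_
    · rw [hu, eq_left_of_eq_succ hconst]
    · gcongr
      exact le_self_add
  · rw [rightTail_eq_add, add_mul, one_mul, add_comm]
    gcongr
    refine tsum_enorm_rpow_le_of_eq_mul hp (e := fun n : ℕ => j + 1 + n)
      (fun a b hab => by simpa using hab) (fun n => ?_) hj
    rw [hu, eq_right_of_eq_succ hconst]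

theorem exists_tail_le_of_surjective_one_sub (hp : p ≠ ∞) (hv : ∀ k, v k ≠ 0)
    (hwv : ∀ k, w (k + 1) * v (k + 1) = v k)
    (h : Surjective (1 - weightedShift p hp w hw :
      lp (fun _ : ℤ => ℂ) p →L[ℂ] lp (fun _ : ℤ => ℂ) p)) :
    ∃ C : ℝ≥0, ∀ j,
      leftTail (fun k => ‖v k‖ₑ ^ p.toReal) j ≤ C * ‖v j‖ₑ ^ p.toReal ∨
      rightTail (fun k => ‖v k‖ₑ ^ p.toReal) j ≤ C * ‖v j‖ₑ ^ p.toReal := by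
  obtain ⟨C, hC0, hC⟩ := ContinuousLinearMap.exists_preimage_norm_le _ h
  lift C to ℝ≥0 using hC0.le
  refine ⟨(2 * C) ^ p.toReal + 1, fun j => ?_⟩
  obtain ⟨y, hy, hyC⟩ := hC (lp.single p j 1)
  have hyC' : ‖y‖ₑ ≤ C := by
    rw [lp.norm_single (zero_lt_one.trans_le Fact.out), norm_one, mul_one] at hyC
    exact enorm_le_coe.2 hyC
  have hconst : (2 * ‖y‖ₑ) ^ p.toReal + 1 ≤ ((2 * C) ^ p.toReal + 1 : ℝ≥0) := by
    rw [ENNReal.coe_add, ENNReal.coe_rpow_of_nonneg _ ENNReal.toReal_nonneg, ENNReal.coe_mul,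
      ENNReal.coe_one, ENNReal.coe_ofNat]
    gcongr
  exact (tail_le_of_sub_weightedShift_eq_single hw hp hv hwv hy).imp
    (fun hl => hl.trans (mul_le_mul_left hconst _)) fun hr => hr.trans (mul_le_mul_left hconst _)

end WeightedShift

section Distortion

variable {X : Type*} {f : Equiv.Perm X} {W : Set X}

theorem image_zpow_image (i j : ℤ) (B : Set X) :
    (f ^ i : Equiv.Perm X) '' ((f ^ j : Equiv.Perm X) '' B) =
      (f ^ (i + j) : Equiv.Perm X) '' B := by
  rw [zpow_add, Equiv.Perm.coe_mul, image_comp]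

theorem image_neg_zpow (k : ℤ) (B : Set X) :
    (f ^ (-k) : Equiv.Perm X) '' B = (f ^ k : Equiv.Perm X) ⁻¹' B := by
  rw [zpow_neg, Equiv.Perm.inv_def, Equiv.image_symm_eq_preimage]

/-- The union of the levels `f ^ j '' W` with index `j ∈ J`. -/
def levelUnion (f : Equiv.Perm X) (W : Set X) (J : Set ℤ) : Set X :=
  ⋃ j ∈ J, (f ^ j : Equiv.Perm X) '' W

theorem compl_levelUnion_subset (hW : ⋃ k : ℤ, (f ^ k : Equiv.Perm X) '' W = univ) (J : Set ℤ) :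
    (levelUnion f W J)ᶜ ⊆ levelUnion f W Jᶜ := by
  intro x hx
  obtain ⟨j, hj⟩ := mem_iUnion.1 (hW ▸ mem_univ x)
  exact mem_biUnion (fun hjJ => hx (mem_biUnion hjJ hj)) hj

variable [MeasurableSpace X] {μ : Measure X}

theorem measurable_zpow (hf : Measurable f) (hf' : Measurable f.symm) (k : ℤ) :
    Measurable (f ^ k : Equiv.Perm X) := by
  induction k with
  | zero => exact measurable_id
  | succ k ih => exact zpow_add_one f k ▸ ih.comp hf
  | pred k ih => exact zpow_sub_one f (-k) ▸ ih.comp hf'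

theorem measurableSet_image_zpow (hf : Measurable f) (hf' : Measurable f.symm) (k : ℤ) {B : Set X}
    (hB : MeasurableSet B) : MeasurableSet ((f ^ k : Equiv.Perm X) '' B) := by
  rw [← neg_neg k, image_neg_zpow]
  exact measurable_zpow hf hf' _ hB

theorem measurableSet_levelUnion (hf : Measurable f) (hf' : Measurable f.symm)
    (hW : MeasurableSet W) (J : Set ℤ) : MeasurableSet (levelUnion f W J) :=
  .biUnion J.to_countable fun j _ => measurableSet_image_zpow hf hf' j hW

/-- `K` is a constant witnessing `HasBoundedDistortion μ f W`. -/
def IsDistortionConstant (μ : Measure X) (f : Equiv.Perm X) (W : Set X) (K : ℝ≥0) : Prop :=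
  ∀ (k : ℤ) (B : Set X), MeasurableSet B → B ⊆ W →
    (K : ℝ≥0∞)⁻¹ * μ ((f ^ k) '' W) * μ B ≤ μ ((f ^ k) '' B) * μ W ∧
    μ ((f ^ k) '' B) * μ W ≤ K * μ ((f ^ k) '' W) * μ B

variable {K : ℝ≥0}

/-- Pulling `B` back to `W` costs one factor `K`, pushing forward to the level `i + j` another. -/
theorem IsDistortionConstant.measure_image_mul_le (hK : IsDistortionConstant μ f W K) (hK0 : K ≠ 0)
    (hf : Measurable f) (hf' : Measurable f.symm) (hW0 : μ W ≠ 0) (hWtop : μ W ≠ ∞) (i j : ℤ)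
    {B : Set X} (hB : MeasurableSet B) (hBW : B ⊆ (f ^ j : Equiv.Perm X) '' W) :
    μ ((f ^ i) '' B) * μ ((f ^ j) '' W) ≤ (K ^ 2 : ℝ≥0) * μ ((f ^ (i + j)) '' W) * μ B := by
  obtain ⟨A, hAW, rfl⟩ := subset_image_iff.1 hBW
  have hA : MeasurableSet A := by
    simpa [image_zpow_image] using measurableSet_image_zpow hf hf' (-j) hB
  have hpull := (hK j A hA hAW).1
  have hpush := (hK (i + j) A hA hAW).2
  have hKinv : (K : ℝ≥0∞) * (K : ℝ≥0∞)⁻¹ = 1 :=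
    ENNReal.mul_inv_cancel (by exact_mod_cast hK0) ENNReal.coe_ne_top
  rw [image_zpow_image, ← ENNReal.mul_le_mul_iff_left hW0 hWtop]
  calc μ ((f ^ (i + j)) '' A) * μ ((f ^ j) '' W) * μ W
      = μ ((f ^ (i + j)) '' A) * μ W * μ ((f ^ j) '' W) := by ring
    _ ≤ K * μ ((f ^ (i + j)) '' W) * μ A * μ ((f ^ j) '' W) := by gcongr
    _ = K * (K * (K : ℝ≥0∞)⁻¹) * μ ((f ^ (i + j)) '' W) * μ A * μ ((f ^ j) '' W) := by
        rw [hKinv, mul_one]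
    _ = K ^ 2 * μ ((f ^ (i + j)) '' W) * ((K : ℝ≥0∞)⁻¹ * μ ((f ^ j) '' W) * μ A) := by ring
    _ ≤ K ^ 2 * μ ((f ^ (i + j)) '' W) * (μ ((f ^ j) '' A) * μ W) := by gcongr
    _ = (K ^ 2 : ℝ≥0) * μ ((f ^ (i + j)) '' W) * μ ((f ^ j) '' A) * μ W := by push_cast; ring

theorem IsDistortionConstant.measure_image_le_of_subset_level (hK : IsDistortionConstant μ f W K)
    (hK0 : K ≠ 0) (hf : Measurable f) (hf' : Measurable f.symm)
    (hμ0 : ∀ j : ℤ, μ ((f ^ j) '' W) ≠ 0) (hμtop : ∀ j : ℤ, μ ((f ^ j) '' W) ≠ ∞)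
    {i j : ℤ} {c : ℝ≥0} (hc : μ ((f ^ (i + j)) '' W) ≤ c * μ ((f ^ j) '' W))
    {B : Set X} (hB : MeasurableSet B) (hBW : B ⊆ (f ^ j : Equiv.Perm X) '' W) :
    μ ((f ^ i) '' B) ≤ (K ^ 2 * c : ℝ≥0) * μ B := by
  rw [← ENNReal.mul_le_mul_iff_left (hμ0 j) (hμtop j)]
  calc μ ((f ^ i) '' B) * μ ((f ^ j) '' W) ≤ (K ^ 2 : ℝ≥0) * μ ((f ^ (i + j)) '' W) * μ B :=
        hK.measure_image_mul_le hK0 hf hf' (by simpa using hμ0 0) (by simpa using hμtop 0) i j hB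
          hBW
    _ ≤ (K ^ 2 : ℝ≥0) * (c * μ ((f ^ j) '' W)) * μ B := by gcongr
    _ = (K ^ 2 * c : ℝ≥0) * μ B * μ ((f ^ j) '' W) := by
        rw [ENNReal.coe_mul]
        ring

theorem IsDistortionConstant.measure_image_le (hK : IsDistortionConstant μ f W K) (hK0 : K ≠ 0)
    (hf : Measurable f) (hf' : Measurable f.symm) (hW : MeasurableSet W)
    (hμ0 : ∀ j : ℤ, μ ((f ^ j) '' W) ≠ 0) (hμtop : ∀ j : ℤ, μ ((f ^ j) '' W) ≠ ∞)
    (hdisj : Pairwise (Disjoint on fun k : ℤ => (f ^ k) '' W)) {J : Set ℤ} {i : ℤ} {c : ℝ≥0}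
    (hc : ∀ j ∈ J, μ ((f ^ (i + j)) '' W) ≤ c * μ ((f ^ j) '' W))
    {B : Set X} (hB : MeasurableSet B) (hBJ : B ⊆ levelUnion f W J) :
    μ ((f ^ i) '' B) ≤ (K ^ 2 * c : ℝ≥0) * μ B := by
  let piece (j : J) : Set X := B ∩ (f ^ (j : ℤ) : Equiv.Perm X) '' W
  have hpiece (j : J) : MeasurableSet (piece j) :=
    hB.inter (measurableSet_image_zpow hf hf' j hW)
  have hpieces : B = ⋃ j, piece j := by
    rw [← inter_iUnion, iUnion_subtype]
    exact (inter_eq_left.2 hBJ).symm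
  have hpdisj : Pairwise (Disjoint on piece) := fun a b hab =>
    (hdisj (Subtype.coe_injective.ne hab)).mono inter_subset_right inter_subset_right
  calc μ ((f ^ i) '' B) = μ (⋃ j, (f ^ i) '' piece j) := by rw [← image_iUnion, ← hpieces]
    _ ≤ ∑' j, μ ((f ^ i) '' piece j) := measure_iUnion_le _
    _ ≤ ∑' j, (K ^ 2 * c : ℝ≥0) * μ (piece j) := ENNReal.tsum_le_tsum fun j =>
        hK.measure_image_le_of_subset_level hK0 hf hf' hμ0 hμtop (hc j j.2) (hpiece j)
          inter_subset_right
    _ = (K ^ 2 * c : ℝ≥0) * μ B := by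
        rw [ENNReal.tsum_mul_left, ← measure_iUnion hpdisj hpiece, ← hpieces]

end Distortion

section IndicatorOperator

variable {X F : Type*} [MeasurableSpace X] {μ : Measure X} [NormedAddCommGroup F] (p : ℝ≥0∞)
  [Fact (1 ≤ p)] (𝕜 : Type*) [NontriviallyNormedField 𝕜] [NormedSpace 𝕜 F] {S : Set X}

/-- Multiplication by the indicator function of a measurable set, as an operator on `L^p`. -/
noncomputable def indicatorOperator (hS : MeasurableSet S) : Lp F p μ →L[𝕜] Lp F p μ :=
  LinearMap.mkContinuous
    { toFun := fun g => ((Lp.memLp g).indicator hS).toLp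
      map_add' := fun g₁ g₂ => by
        rw [← MemLp.toLp_add, MemLp.toLp_eq_toLp_iff, ← indicator_add']
        filter_upwards [Lp.coeFn_add g₁ g₂] with x hx
        simp only [indicator, hx]
      map_smul' := fun a g => by
        rw [RingHom.id_apply, ← MemLp.toLp_const_smul, MemLp.toLp_eq_toLp_iff]
        filter_upwards [Lp.coeFn_smul a g] with x hx
        simp only [indicator, hx, Pi.smul_apply, smul_ite, smul_zero] }
    1 fun g => by
      rw [one_mul]
      refine Lp.norm_le_norm_of_ae_le ?_
      filter_upwards [((Lp.memLp g).indicator hS).coeFn_toLp] with x hx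
      exact hx ▸ norm_indicator_le_norm_self g x

theorem indicatorOperator_coeFn (hS : MeasurableSet S) (g : Lp F p μ) :
    indicatorOperator p 𝕜 hS g =ᵐ[μ] S.indicator (g : X → F) :=
  ((Lp.memLp g).indicator hS).coeFn_toLp

theorem indicatorOperator_sub_one (hS : MeasurableSet S) :
    (indicatorOperator p 𝕜 hS - 1 : Lp F p μ →L[𝕜] Lp F p μ) =
      -indicatorOperator p 𝕜 hS.compl := by
  rw [sub_eq_iff_eq_add', ← sub_eq_add_neg, eq_sub_iff_add_eq]
  ext1 g
  refine Lp.ext ?_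
  filter_upwards [indicatorOperator_coeFn p 𝕜 hS g, indicatorOperator_coeFn p 𝕜 hS.compl g,
    Lp.coeFn_add (indicatorOperator p 𝕜 hS g) (indicatorOperator p 𝕜 hS.compl g)] with x h h' hadd
  exact hadd.trans (by rw [Pi.add_apply, h, h']; exact congrFun (indicator_self_add_compl S g) x)

end IndicatorOperator

section CompositionOperator

theorem eLpNorm_indicator_comp_le {X Y F : Type*} [MeasurableSpace X] [MeasurableSpace Y]
    [NormedAddCommGroup F] {μ : Measure X} {ν : Measure Y} {h : X → Y}
    (hh : Measure.QuasiMeasurePreserving h μ ν) {S : Set Y} (hS : MeasurableSet S) {c : ℝ≥0∞}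
    (hc : ∀ B, MeasurableSet B → B ⊆ S → μ (h ⁻¹' B) ≤ c * ν B) (p : ℝ≥0∞) {g : Y → F}
    (hg : AEStronglyMeasurable g ν) :
    eLpNorm (S.indicator g ∘ h) p μ ≤ c ^ (1 / p).toReal * eLpNorm g p ν := by
  have hmap : (μ.map h).restrict S ≤ c • ν := by
    refine Measure.le_iff.2 fun B hB => ?_
    rw [Measure.restrict_apply hB, Measure.map_apply hh.measurable (hB.inter hS),
      Measure.smul_apply, smul_eq_mul]
    exact (hc _ (hB.inter hS) inter_subset_right).trans (by gcongr; exact inter_subset_left)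
  calc eLpNorm (S.indicator g ∘ h) p μ = eLpNorm g p ((μ.map h).restrict S) := by
        rw [← eLpNorm_map_measure ((hg.indicator hS).mono_ac hh.absolutelyContinuous)
          hh.measurable.aemeasurable, eLpNorm_indicator_eq_eLpNorm_restrict hS]
    _ ≤ eLpNorm g p (c • ν) := eLpNorm_mono_measure g hmap
    _ ≤ c ^ (1 / p).toReal * eLpNorm g p ν := eLpNorm_smul_measure_le _ g p ν

variable {X : Type*} [MeasurableSpace X] {μ : Measure X} (p : ℝ≥0∞) [Fact (1 ≤ p)]

theorem compositionOperator_leftInverse {f g : X → X} (hf : IsCompositionSystem μ f)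
    (hg : IsCompositionSystem μ g) (h : LeftInverse f g) :
    LeftInverse (compositionOperator p hg) (compositionOperator p hf) := fun φ =>
  Lp.ext <| calc
    (compositionOperator p hg (compositionOperator p hf φ) : X → ℂ)
        =ᵐ[μ] compositionOperator p hf φ ∘ g := compositionOperator_coeFn p hg _
    _ =ᵐ[μ] (φ ∘ f) ∘ g := hg.quasiMeasurePreserving.ae_eq_comp (compositionOperator_coeFn p hf φ)
    _ = φ := by rw [comp_assoc, h.comp_eq_id, comp_id]

variable {f : Equiv.Perm X}

/-- The composition operator of an invertible `f`, as an automorphism of `L^p`. -/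
noncomputable def compositionOperatorEquiv (hf : IsCompositionSystem μ f)
    (hf' : IsCompositionSystem μ f.symm) : Lp ℂ p μ ≃L[ℂ] Lp ℂ p μ :=
  .equivOfInverse (compositionOperator p hf) (compositionOperator p hf')
    (compositionOperator_leftInverse p hf hf' f.right_inv)
    (compositionOperator_leftInverse p hf' hf f.left_inv)

theorem quasiMeasurePreserving_zpow (hf : IsCompositionSystem μ f)
    (hf' : IsCompositionSystem μ f.symm) (k : ℤ) :
    Measure.QuasiMeasurePreserving (f ^ k : Equiv.Perm X) μ μ := by
  induction k with
  | zero => exact .id μ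
  | succ k ih => exact zpow_add_one f k ▸ ih.comp hf.quasiMeasurePreserving
  | pred k ih => exact zpow_sub_one f (-k) ▸ ih.comp hf'.quasiMeasurePreserving

theorem compositionOperatorEquiv_zpow_coeFn (hf : IsCompositionSystem μ f)
    (hf' : IsCompositionSystem μ f.symm) (k : ℤ) (g : Lp ℂ p μ) :
    (compositionOperatorEquiv p hf hf' ^ k : Lp ℂ p μ ≃L[ℂ] Lp ℂ p μ) g =ᵐ[μ]
      g ∘ (f ^ k : Equiv.Perm X) := by
  induction k with
  | zero => rfl
  | succ k ih =>
    rw [add_comm, zpow_one_add, add_comm, zpow_add_one]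
    exact (compositionOperator_coeFn p hf _).trans (hf.quasiMeasurePreserving.ae_eq_comp ih)
  | pred k ih =>
    rw [sub_eq_neg_add, zpow_add, zpow_neg_one, neg_add_eq_sub, zpow_sub_one]
    exact (compositionOperator_coeFn p hf' _).trans (hf'.quasiMeasurePreserving.ae_eq_comp ih)

theorem norm_compositionOperatorEquiv_zpow_comp_indicatorOperator_le (hf : IsCompositionSystem μ f)
    (hf' : IsCompositionSystem μ f.symm) (k : ℤ) {S : Set X} (hS : MeasurableSet S) {c : ℝ≥0}
    (hc : ∀ B, MeasurableSet B → B ⊆ S → μ ((f ^ (-k)) '' B) ≤ c * μ B) :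
    ‖((compositionOperatorEquiv p hf hf' ^ k : Lp ℂ p μ ≃L[ℂ] Lp ℂ p μ) :
      Lp ℂ p μ →L[ℂ] Lp ℂ p μ) ∘L indicatorOperator p ℂ hS‖ ≤ (c : ℝ) ^ (1 / p).toReal := by
  refine ContinuousLinearMap.opNorm_le_bound _ (by positivity) fun g => ?_
  have hfk := quasiMeasurePreserving_zpow hf hf' k
  simp only [image_neg_zpow] at hc
  have hae := (compositionOperatorEquiv_zpow_coeFn p hf hf' k (indicatorOperator p ℂ hS g)).trans
    (hfk.ae_eq_comp (indicatorOperator_coeFn p ℂ hS g))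
  have hle := eLpNorm_indicator_comp_le hfk hS hc p (Lp.aestronglyMeasurable g)
  rw [← eLpNorm_congr_ae hae] at hle
  have htop : (c : ℝ≥0∞) ^ (1 / p).toReal * eLpNorm g p μ ≠ ∞ :=
    ENNReal.mul_ne_top (by simp) (Lp.memLp g).2.ne
  simpa [Lp.norm_def, ← ENNReal.toReal_rpow] using ENNReal.toReal_mono htop hle

theorem summable_geometric_rpow {D θ : ℝ≥0} {r : ℝ} (hθ : θ < 1) (hr : 0 < r) :
    Summable fun k : ℕ => ((D * θ ^ k : ℝ≥0) : ℝ) ^ r := by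
  have hgeom (k : ℕ) : ((D * θ ^ k : ℝ≥0) : ℝ) ^ r = (D : ℝ) ^ r * ((θ : ℝ) ^ r) ^ k := by
    push_cast
    rw [Real.mul_rpow D.coe_nonneg (by positivity), Real.rpow_pow_comm θ.coe_nonneg]
  simp only [hgeom]
  exact (summable_geometric_of_lt_one (by positivity)
    (Real.rpow_lt_one θ.coe_nonneg hθ hr)).mul_left _

theorem stronglyStructurallyStable_compositionOperator {p : ℝ≥0∞} [Fact (1 ≤ p)] (hp : p ≠ ∞)
    (hf : IsCompositionSystem μ f) (hf' : IsCompositionSystem μ f.symm) {S : Set X}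
    (hS : MeasurableSet S) {D θ : ℝ≥0} (hθ : θ < 1)
    (hbackward : ∀ (k : ℕ) (B : Set X), MeasurableSet B → B ⊆ S →
      μ ((f ^ (-k : ℤ)) '' B) ≤ (D * θ ^ k : ℝ≥0) * μ B)
    (hforward : ∀ (k : ℕ) (B : Set X), MeasurableSet B → B ⊆ Sᶜ →
      μ ((f ^ (k : ℤ)) '' B) ≤ (D * θ ^ k : ℝ≥0) * μ B) :
    StronglyStructurallyStable (compositionOperator p hf) := by
  have hp1 : 1 ≤ p := Fact.out
  have hr : 0 < (1 / p).toReal :=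
    ENNReal.toReal_pos (by simpa using hp) (by simpa using (zero_lt_one.trans_le hp1).ne')
  have hsum := summable_geometric_rpow (D := D) hθ hr
  have hkernel : IsGreenKernel (compositionOperatorEquiv p hf hf' : Lp ℂ p μ →L[ℂ] Lp ℂ p μ)
      (splittingKernel (compositionOperatorEquiv p hf hf') (indicatorOperator p ℂ hS)) := by
    refine isGreenKernel_splittingKernel
      (hsum.of_nonneg_of_le (fun _ => norm_nonneg _) fun k => ?_)
      (((summable_nat_add_iff 1).2 hsum).of_nonneg_of_le (fun _ => norm_nonneg _) fun k => ?_)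
    · exact norm_compositionOperatorEquiv_zpow_comp_indicatorOperator_le p hf hf' k hS (hbackward k)
    · rw [indicatorOperator_sub_one, ContinuousLinearMap.comp_neg, norm_neg]
      refine norm_compositionOperatorEquiv_zpow_comp_indicatorOperator_le p hf hf' _ hS.compl ?_
      simpa using hforward (k + 1)
  exact hkernel.stronglyStructurallyStable

end CompositionOperator

section Dissipative

variable {X : Type*} [MeasurableSpace X] {μ : Measure X} {f : Equiv.Perm X} {W : Set X}

theorem IsCompositionSystem.measurable_symm (hf : IsCompositionSystem μ f) :
    Measurable f.symm := fun B hB => by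
  rw [← Equiv.image_eq_preimage_symm]
  exact hf.measurableSet_image B hB

theorem IsCompositionSystem.symm (hf : IsCompositionSystem μ f) {c : ℝ≥0}
    (hc : ∀ B, MeasurableSet B → μ (f '' B) ≤ c * μ B) : IsCompositionSystem μ f.symm where
  sigmaFinite := hf.sigmaFinite
  injective := f.symm.injective
  measurable := hf.measurable_symm
  measurableSet_image B hB := by
    rw [Equiv.image_symm_eq_preimage]
    exact hf.measurable hB
  exists_bound := by
    refine ⟨c + 1, by positivity, fun B hB => ?_⟩
    rw [← Equiv.image_eq_preimage_symm]
    exact (hc B hB).trans (by gcongr; exact le_self_add)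

theorem IsDissipativeSystem.measure_image_ne_zero (hf : IsCompositionSystem μ f)
    (hW : IsDissipativeSystem μ f W) (k : ℤ) : μ ((f ^ k) '' W) ≠ 0 := by
  have hstep (k : ℤ) : μ ((f ^ k) '' W) = 0 ↔ μ ((f ^ (k + 1)) '' W) = 0 := by
    have himage := measurableSet_image_zpow hf.measurable hf.measurable_symm (k + 1)
      hW.measurableSet
    rw [← hW.nonsingular _ himage, add_comm k 1, ← image_zpow_image, zpow_one,
      preimage_image_eq _ f.injective]
  induction k with
  | zero => simpa using hW.measure_pos.ne'
  | succ k ih => rwa [Ne, ← hstep]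
  | pred k ih => rwa [Ne, hstep, sub_add_cancel]

theorem IsDistortionConstant.isCompositionSystem_symm {K : ℝ≥0} (hK : IsDistortionConstant μ f W K)
    (hK0 : K ≠ 0) (hf : IsCompositionSystem μ f) (hW : IsDissipativeSystem μ f W)
    (hμtop : ∀ k : ℤ, μ ((f ^ k) '' W) ≠ ∞) {c : ℝ≥0}
    (hc : ∀ k : ℤ, μ ((f ^ k) '' W) ≤ c * μ ((f ^ (k - 1)) '' W)) :
    IsCompositionSystem μ f.symm := by
  refine hf.symm (c := K ^ 2 * c) fun B hB => ?_
  refine hK.measure_image_le hK0 hf.measurable hf.measurable_symm hW.measurableSet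
    (hW.measure_image_ne_zero hf) hμtop hW.pairwise_disjoint (J := univ) (i := 1)
    (fun j _ => ?_) hB ?_
  · simpa using hc (1 + j)
  · simp [levelUnion, hW.iUnion_eq]

theorem IsDistortionConstant.stronglyStructurallyStable {K : ℝ≥0}
    (hK : IsDistortionConstant μ f W K) (hK0 : K ≠ 0) {p : ℝ≥0∞} [Fact (1 ≤ p)] (hp : p ≠ ∞)
    (hf : IsCompositionSystem μ f) (hf' : IsCompositionSystem μ f.symm)
    (hW : IsDissipativeSystem μ f W) (hμtop : ∀ k : ℤ, μ ((f ^ k) '' W) ≠ ∞)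
    {J : Set ℤ} {D θ : ℝ≥0} (hJ : IsGeometricDichotomy (fun k => μ ((f ^ k) '' W)) J D θ) :
    StronglyStructurallyStable (compositionOperator p hf) := by
  have hdist {J : Set ℤ} {i : ℤ} {c : ℝ≥0}
      (hc : ∀ j ∈ J, μ ((f ^ (i + j)) '' W) ≤ c * μ ((f ^ j) '' W)) {B : Set X}
      (hB : MeasurableSet B) (hBJ : B ⊆ levelUnion f W J) :=
    hK.measure_image_le hK0 hf.measurable hf'.measurable hW.measurableSet
      (hW.measure_image_ne_zero hf) hμtop hW.pairwise_disjoint hc hB hBJ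
  refine stronglyStructurallyStable_compositionOperator hp hf hf' (D := K ^ 2 * D)
    (measurableSet_levelUnion hf.measurable hf'.measurable hW.measurableSet J) hJ.rate_lt_one
    (fun k B hB hBJ => ?_) fun k B hB hBJ => ?_
  · rw [mul_assoc]
    exact hdist (fun j hj => neg_add_eq_sub (k : ℤ) j ▸ hJ.left_decay j hj k) hB hBJ
  · rw [mul_assoc]
    exact hdist (fun j hj => add_comm j k ▸ hJ.right_decay j hj k) hB
      (hBJ.trans (compl_levelUnion_subset hW.iUnion_eq J))

variable {p : ℝ≥0∞} {k : ℤ}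

theorem measure_image_ne_top_of_systemWeight_ne_zero (hp : 0 < p.toReal)
    (h : systemWeight p μ f W k ≠ 0) : μ ((f ^ k) '' W) ≠ ∞ := fun htop => h <| by
  rw [systemWeight, htop, ENNReal.div_top, ENNReal.toReal_zero,
    Real.zero_rpow (one_div_pos.2 hp).ne', Complex.ofReal_zero]

/-- The `p`-th root of the measure of a level. The weight `w_k` is the quotient of the roots at
`k - 1` and `k`, so this sequence is a formal fixed vector of `B_w`. -/
noncomputable def levelRoot (p : ℝ≥0∞) (μ : Measure X) (f : Equiv.Perm X) (W : Set X)
    (k : ℤ) : ℂ :=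
  ((μ ((f ^ k) '' W)).toReal ^ (1 / p.toReal) : ℝ)

theorem levelRoot_ne_zero (h0 : μ ((f ^ k) '' W) ≠ 0) (htop : μ ((f ^ k) '' W) ≠ ∞) :
    levelRoot p μ f W k ≠ 0 :=
  Complex.ofReal_ne_zero.2 (Real.rpow_pos_of_pos (ENNReal.toReal_pos h0 htop) _).ne'

theorem systemWeight_mul_levelRoot (h0 : μ ((f ^ k) '' W) ≠ 0) (htop : μ ((f ^ k) '' W) ≠ ∞) :
    systemWeight p μ f W k * levelRoot p μ f W k = levelRoot p μ f W (k - 1) := by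
  simp only [systemWeight, levelRoot, ← Complex.ofReal_mul]
  rw [← Real.mul_rpow ENNReal.toReal_nonneg ENNReal.toReal_nonneg, ← ENNReal.toReal_mul,
    ENNReal.div_mul_cancel h0 htop]

theorem enorm_levelRoot_rpow (hp : 0 < p.toReal) (htop : μ ((f ^ k) '' W) ≠ ∞) :
    ‖levelRoot p μ f W k‖ₑ ^ p.toReal = μ ((f ^ k) '' W) := by
  rw [levelRoot, ← ofReal_norm, Complex.norm_real, Real.norm_of_nonneg (by positivity),
    ENNReal.ofReal_rpow_of_nonneg (by positivity) hp.le, one_div,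
    Real.rpow_inv_rpow ENNReal.toReal_nonneg hp.ne', ENNReal.ofReal_toReal htop]

theorem measure_image_le_of_one_le_mul_norm_systemWeight (hp : 0 < p.toReal)
    (h0 : μ ((f ^ k) '' W) ≠ 0) (htop : ∀ k : ℤ, μ ((f ^ k) '' W) ≠ ∞) {N : ℝ≥0}
    (hN : 1 ≤ N * ‖systemWeight p μ f W k‖) :
    μ ((f ^ k) '' W) ≤ (N ^ p.toReal : ℝ≥0) * μ ((f ^ (k - 1)) '' W) := by
  have hN' : 1 ≤ N * ‖systemWeight p μ f W k‖ₑ := by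
    rw [enorm_eq_nnnorm]
    exact_mod_cast hN
  rw [← enorm_levelRoot_rpow hp (htop k), ← enorm_levelRoot_rpow hp (htop (k - 1)),
    ← systemWeight_mul_levelRoot h0 (htop k), enorm_mul, ENNReal.coe_rpow_of_nonneg _ hp.le,
    ← ENNReal.mul_rpow_of_nonneg _ _ hp.le, ← mul_assoc]
  gcongr
  exact le_mul_of_one_le_left' hN'

end Dissipative

theorem theoremW_general {X : Type*} [MeasurableSpace X] (μ : Measure X) (f : Equiv.Perm X)
    (W : Set X) (p : ℝ≥0∞) [Fact (1 ≤ p)] (hp : p ≠ ∞)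
    (hf : IsCompositionSystem μ f) (hW : IsDissipativeSystem μ f W)
    (hK : HasBoundedDistortion μ f W)
    (hinv : (weightedShift p hp (systemWeight p μ f W) (systemWeight_bounded p hf hW)).IsInvertible)
    (hsurj : Surjective (1 - weightedShift p hp (systemWeight p μ f W)
      (systemWeight_bounded p hf hW) : lp (fun _ : ℤ => ℂ) p →L[ℂ] lp (fun _ : ℤ => ℂ) p)) :
    StronglyStructurallyStable (compositionOperator p hf) := by
  have hp0 : 0 < p.toReal := ENNReal.toReal_pos (zero_lt_one.trans_le Fact.out).ne' hp
  obtain ⟨K, hK0, hK : IsDistortionConstant μ f W K⟩ := hK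
  obtain ⟨N, hN⟩ := exists_one_le_mul_norm_weight _ hp hinv
  have hμ0 := hW.measure_image_ne_zero hf
  have hμtop (k : ℤ) : μ ((f ^ k) '' W) ≠ ∞ :=
    measure_image_ne_top_of_systemWeight_ne_zero hp0 fun hw => absurd (hN k) (by simp [hw])
  have hf' : IsCompositionSystem μ f.symm := hK.isCompositionSystem_symm hK0.ne' hf hW hμtop
    fun k => measure_image_le_of_one_le_mul_norm_systemWeight hp0 (hμ0 k) hμtop (hN k)
  obtain ⟨C, hC⟩ := exists_tail_le_of_surjective_one_sub _ hp (v := levelRoot p μ f W)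
    (fun k => levelRoot_ne_zero (hμ0 k) (hμtop k))
    (fun k => by
      rw [systemWeight_mul_levelRoot (hμ0 _) (hμtop _), add_sub_cancel_right]) hsurj
  simp only [enorm_levelRoot_rpow hp0 (hμtop _)] at hC
  obtain ⟨J, D, θ, hJ⟩ := exists_isGeometricDichotomy hC
  exact hK.stronglyStructurallyStable hK0.ne' hp hf hf' hW hμtop hJ

theorem theoremW {X : Type*} [MeasurableSpace X] (μ : Measure X) (f : Equiv.Perm X) (W : Set X)
    (p : ℝ≥0∞) [Fact (1 ≤ p)] (hp : p ≠ ∞)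
    (hf : IsCompositionSystem μ f) (hW : IsDissipativeSystem μ f W)
    (hK : HasBoundedDistortion μ f W)
    (hB : StronglyStructurallyStable
      (weightedShift p hp (systemWeight p μ f W) (systemWeight_bounded p hf hW))) :
    StronglyStructurallyStable (compositionOperator p hf) :=
  theoremW_general μ f W p hp hf hW hK hB.1 hB.surjective_one_sub
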